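/- Let $\mathbb{K}$ be a field of characteristic zero and let $\mathfrak{h}=\mathbb{K}\langle x,y\rangle$, $\mathfrak{h}^1=\mathbb{K}+\mathfrak{h}y$, $\mathfrak{h}^0=\mathbb{K}+x\mathfrak{h}y$, $z_k=x^{k-1}y$ for $k\ge 1$. Let $\diamond$ be the shuffle product on $\mathfrak{h}$ (bilinear, with $1\diamond w=w\diamond 1=w$ and $au\diamond bv=a(u\diamond bv)+b(au\diamond v)$ for letters $a,b$ and words $u,v,w$), and let $\ast$ be the stuffle product on $\mathfrak{h}^1$ (bilinear, with $1\ast w=w\ast 1=w$ and $z_ku\ast z_lv=z_k(u\ast z_lv)+z_l(z_ku\ast v)+z_{k+l}(u\ast v)$ for words $u,v,w$ of $\mathfrak{h}^1$). Every $w\in\mathfrak{h}^1$ can be written uniquely as a finite sum $w=\sum_{i\ge 0} w_i\diamond y^{\diamond i}$ with $w_i\in\mathfrak{h}^0$, where $y^{\diamond i}$ is the $i$-th power for $\diamond$; put $\mathrm{reg}(w)=w_0$. Let $S:\mathfrak{h}\to\mathfrak{h}$ be the linear map with $S(1)=1$ and $S(wa)=\sigma(w)a$ for words $w$ and letters $a$,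 where $\sigma$ is the algebra automorphism of $\mathfrak{h}$ with $\sigma(x)=x$, $\sigma(y)=x+y$; it maps $\mathfrak{h}^0$ into itself. Let $R$ be a commutative unital $\mathbb{K}$-algebra and $Z_R:\mathfrak{h}^0\to R$ a $\mathbb{K}$-linear map satisfying the regularized double shuffle relations, i.e. $Z_R(1)=1$, $Z_R(u\diamond v)=Z_R(u)Z_R(v)=Z_R(u\ast v)$ for all $u,v\in\mathfrak{h}^0$, and $Z_R(\mathrm{reg}(w_1\diamond w_0-w_1\ast w_0))=0$ for all $w_1\in\mathfrak{h}^1$, $w_0\in\mathfrak{h}^0$. For positive integers $k_1,\dots,k_n$ with $k_1\ge 2$ (or $n=0$) put $$\zeta_R(k_1,\dots,k_n)=Z_R(z_{k_1}\cdots z_{k_n}),\qquad \zeta_R^\star(k_1,\dots,k_n)=Z_R(S(z_{k_1}\cdots z_{k_n})),$$ and let $\{2k\}^n$ be the sequence $2k,\dots,2k$ of length $n$. Let $k$ be a positive integer and $\rho_k=e^{\pi\sqrt{-1}/k}\in\mathbb{C}$. Let $A$ be a commutative $R$-algebra together with a $\mathbb{Q}$-algebra homomorphism $\mathbb{Q}(\rho_k)\to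 A$ (the image of $\rho_k$ is again written $\rho_k$), and let $\lambda\in A$ satisfy $\lambda^2=-24\,\zeta_R(2)$. Then, in the ring $A[[t]]$ of formal power series, $$\sum_{n=0}^{\infty}(-1)^n\zeta_R(\{2k\}^n)\,t^{2nk}=\prod_{j=0}^{k-1}\frac{e^{\lambda\rho_k^jt/2}-e^{-\lambda\rho_k^jt/2}}{\lambda\rho_k^jt}$$ and $$\sum_{n=0}^{\infty}\zeta_R^{\star}(\{2k\}^n)\,t^{2nk}=\prod_{j=0}^{k-1}\frac{\lambda\rho_k^jt}{e^{\lambda\rho_k^jt/2}-e^{-\lambda\rho_k^jt/2}}.$$ Here the factors are obtained by substituting $s=\lambda\rho_k^jt$ into the power series $\frac{e^{s/2}-e^{-s/2}}{s}=\sum_{n\ge 0}\frac{s^{2n}}{4^n(2n+1)!}$ and into its multiplicative inverse. -/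

import Mathlib

noncomputable section

namespace MZV

/-- The two-letter alphabet. -/
inductive Letter : Type
  | x
  | y

/-- The algebra `𝔥 = K⟨x, y⟩` of noncommutative polynomials; its `K`-basis is the set of words. -/
abbrev NC (K : Type*) [Field K] : Type _ := MonoidAlgebra K (FreeMonoid Letter)

section Algebra

variable {K : Type*} [Field K]

/-- A word, as an element of `𝔥`. -/
def word (w : List Letter) : NC K := MonoidAlgebra.of K (FreeMonoid Letter) (FreeMonoid.ofList w)

variable (K) in
/-- The letter `x` in `𝔥`. -/
def X : NC K := word [Letter.x]

variable (K) in
/-- The letter `y` in `𝔥`. -/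
def Y : NC K := word [Letter.y]

theorem word_nil : (word [] : NC K) = 1 := rfl

theorem word_append (u v : List Letter) : (word (u ++ v) : NC K) = word u * word v := by
  simp [word]

theorem word_cons (a : Letter) (v : List Letter) : (word (a :: v) : NC K) = word [a] * word v :=
  word_append [a] v

theorem nc_induction {P : NC K → Prop} (p : NC K) (hw : ∀ w, P (word w))
    (hadd : ∀ p q, P p → P q → P (p + q)) (hsmul : ∀ (c : K) p, P p → P (c • p)) : P p :=
  MonoidAlgebra.induction_on p (fun w => hw (FreeMonoid.toList w)) hadd hsmul

/-- The `K`-linear map on `𝔥` with prescribed values on words. -/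
def wordLift {M : Type*} [AddCommMonoid M] [Module K M] (f : List Letter → M) : NC K →ₗ[K] M :=
  (Finsupp.lift M K (FreeMonoid Letter) (fun w => f (FreeMonoid.toList w))).comp
    (MonoidAlgebra.coeffLinearEquiv K).toLinearMap

@[simp]
theorem wordLift_word {M : Type*} [AddCommMonoid M] [Module K M] (f : List Letter → M)
    (w : List Letter) : wordLift f (word w : NC K) = f w := by
  simp [wordLift, word]

/-- `𝔥¹ = K + 𝔥 y`. -/
def h1 (K : Type*) [Field K] : Submodule K (NC K) :=
  1 ⊔ LinearMap.range (LinearMap.mulRight K (Y K))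

/-- `𝔥⁰ = K + x 𝔥 y`. -/
def h0 (K : Type*) [Field K] : Submodule K (NC K) :=
  1 ⊔ LinearMap.range ((LinearMap.mulLeft K (X K)).comp (LinearMap.mulRight K (Y K)))

/-! ### The words `z_k` -/

variable (K) in
/-- `z_k = x^{k-1} y`. -/
def z (k : ℕ+) : NC K := X K ^ ((k : ℕ) - 1) * Y K

variable (K) in
/-- `z_{k_1} ⋯ z_{k_n}`. -/
def zWord (ks : List ℕ+) : NC K := (ks.map (z K)).prod

/-- An index is admissible if it is empty or its first entry is at least `2`. -/
def Admissible (ks : List ℕ+) : Prop := ∀ k ∈ ks.head?, 2 ≤ k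

/-! ### The shuffle product -/

/-- The shuffle product of two words. -/
def shuffleWord : List Letter → List Letter → NC K
  | [], v => word v
  | a :: u, [] => word (a :: u)
  | a :: u, b :: v => word [a] * shuffleWord u (b :: v) + word [b] * shuffleWord (a :: u) v
termination_by u v => u.length + v.length

/-- The shuffle product on `𝔥`. -/
def shuffle : NC K →ₗ[K] NC K →ₗ[K] NC K :=
  wordLift fun u => wordLift fun v => shuffleWord u v

/-- The shuffle powers. -/
def shufflePow (w : NC K) : ℕ → NC K
  | 0 => 1
  | n + 1 => shuffle w (shufflePow w n)

/-! ### The stuffle product -/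

/-- `indexAux m w` is the index of the word `x^m w` written as `z_{k_1} ⋯ z_{k_n}`; letters `x` after the last `y` (absent from the words of `𝔥¹`) are dropped. -/
def indexAux : ℕ → List Letter → List ℕ+
  | _, [] => []
  | m, Letter.x :: w => indexAux (m + 1) w
  | m, Letter.y :: w => m.succPNat :: indexAux 0 w

/-- The index `(k_1, …, k_n)` of the word `z_{k_1} ⋯ z_{k_n}` of `𝔥¹`. -/
def indexOf (w : List Letter) : List ℕ+ := indexAux 0 w

/-- The stuffle product of `z_{k_1} ⋯ z_{k_n}` and `z_{l_1} ⋯ z_{l_m}`. -/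
def stuffleIndex : List ℕ+ → List ℕ+ → NC K
  | [], ls => zWord K ls
  | k :: ks, [] => zWord K (k :: ks)
  | k :: ks, l :: ls =>
      z K k * stuffleIndex ks (l :: ls) + z K l * stuffleIndex (k :: ks) ls
        + z K (k + l) * stuffleIndex ks ls
termination_by ks ls => ks.length + ls.length

/-- The stuffle product: the bilinear map on `𝔥` which is the stuffle product on the words of `𝔥¹`.
It is only ever applied to elements of `𝔥¹`; its values on other words are irrelevant. -/
def stuffle : NC K →ₗ[K] NC K →ₗ[K] NC K :=
  wordLift fun u => wordLift fun v => stuffleIndex (indexOf u) (indexOf v)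

theorem zWord_eq_word (ks : List ℕ+) : (zWord K ks : NC K) =
    word (ks.flatMap fun k : ℕ+ => List.replicate ((k : ℕ) - 1) Letter.x ++ [Letter.y]) := by
  have hx : ∀ n : ℕ, (word (List.replicate n Letter.x) : NC K) = X K ^ n := fun n => by
    induction n with
    | zero => rfl
    | succ n ih => rw [List.replicate_succ, word_cons, ih, pow_succ']; rfl
  induction ks with
  | nil => rfl
  | cons k ks ih =>
    rw [List.flatMap_cons, word_append, word_append, ← ih, hx]
    simp [zWord, z, Y]

theorem indexAux_replicate (m n : ℕ) (w : List Letter) :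
    indexAux m (List.replicate n Letter.x ++ w) = indexAux (m + n) w := by
  induction n generalizing m with
  | zero => rfl
  | succ n ih =>
    rw [List.replicate_succ, List.cons_append, indexAux, ih]
    congr 1
    omega

theorem indexOf_flatMap (ks : List ℕ+) :
    indexOf (ks.flatMap fun k : ℕ+ => List.replicate ((k : ℕ) - 1) Letter.x ++ [Letter.y]) = ks := by
  induction ks with
  | nil => rfl
  | cons k ks ih =>
    rw [List.flatMap_cons, indexOf, List.append_assoc, indexAux_replicate]
    rw [List.singleton_append, indexAux, ← indexOf, ih]
    congr 1
    have := k.pos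
    apply PNat.eq
    rw [Nat.succPNat_coe]
    omega

/-- The stuffle product on the basis of `𝔥¹`. -/
theorem stuffle_zWord (ks ls : List ℕ+) :
    stuffle (zWord K ks) (zWord K ls) = stuffleIndex ks ls := by
  rw [zWord_eq_word, zWord_eq_word, stuffle, wordLift_word, wordLift_word, indexOf_flatMap,
    indexOf_flatMap]

/-! ### The map `S` -/

/-- The algebra endomorphism `σ` of `𝔥` with `σ(x) = x` and `σ(y) = x + y`. -/
def sigma : NC K →ₐ[K] NC K :=
  MonoidAlgebra.lift K (NC K) (FreeMonoid Letter)
    (FreeMonoid.lift fun a => match a with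
      | Letter.x => X K
      | Letter.y => X K + Y K)

/-- The linear map `S` with `S(1) = 1` and `S(w a) = σ(w) a` for words `w` and letters `a`. -/
def S : NC K →ₗ[K] NC K :=
  wordLift fun w => match w.getLast? with
    | none => 1
    | some a => sigma (word w.dropLast) * word [a]

theorem sigma_X : sigma (X K) = X K := by
  simp [sigma, X, word]

theorem sigma_Y : sigma (Y K) = X K + Y K := by
  simp [sigma, Y, word]

theorem S_one : S (1 : NC K) = 1 := by
  rw [← word_nil, S, wordLift_word]; rfl

theorem S_mul_letter (w : NC K) (a : Letter) : S (w * word [a]) = sigma w * word [a] := by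
  induction w using nc_induction with
  | hw w => rw [← word_append, S, wordLift_word]; simp
  | hadd p q hp hq => simp [add_mul, hp, hq]
  | hsmul c p hp => simp [hp]

/-! ### Membership and closure facts -/

theorem one_mem_h1 : (1 : NC K) ∈ h1 K :=
  Submodule.mem_sup_left (Submodule.one_le.1 le_rfl)

theorem one_mem_h0 : (1 : NC K) ∈ h0 K :=
  Submodule.mem_sup_left (Submodule.one_le.1 le_rfl)

theorem mul_Y_mem_h1 (w : NC K) : w * Y K ∈ h1 K :=
  Submodule.mem_sup_right ⟨w, rfl⟩

theorem X_mul_Y_mem_h0 (w : NC K) : X K * (w * Y K) ∈ h0 K :=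
  Submodule.mem_sup_right ⟨w, rfl⟩

theorem h1_induction {P : NC K → Prop} {p : NC K} (hp : p ∈ h1 K) (h1' : P 1)
    (hw : ∀ w, P (word w * Y K))
    (hadd : ∀ p q, P p → P q → P (p + q)) (hsmul : ∀ (c : K) p, P p → P (c • p)) : P p := by
  obtain ⟨a, ha, b, ⟨w, rfl⟩, rfl⟩ := Submodule.mem_sup.1 hp
  obtain ⟨c, rfl⟩ := Submodule.mem_one.1 ha
  refine hadd _ _ (by rw [Algebra.algebraMap_eq_smul_one]; exact hsmul _ _ h1') ?_
  clear hp ha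
  induction w using nc_induction with
  | hw w => exact hw w
  | hadd p q hp hq => rw [map_add]; exact hadd _ _ hp hq
  | hsmul c' p hp => rw [map_smul]; exact hsmul _ _ hp

theorem h0_induction {P : NC K → Prop} {p : NC K} (hp : p ∈ h0 K) (h1' : P 1)
    (hw : ∀ w, P (X K * (word w * Y K)))
    (hadd : ∀ p q, P p → P q → P (p + q)) (hsmul : ∀ (c : K) p, P p → P (c • p)) : P p := by
  obtain ⟨a, ha, b, ⟨w, rfl⟩, rfl⟩ := Submodule.mem_sup.1 hp
  obtain ⟨c, rfl⟩ := Submodule.mem_one.1 ha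
  refine hadd _ _ (by rw [Algebra.algebraMap_eq_smul_one]; exact hsmul _ _ h1') ?_
  clear hp ha
  induction w using nc_induction with
  | hw w => exact hw w
  | hadd p q hp hq => rw [map_add]; exact hadd _ _ hp hq
  | hsmul c' p hp => rw [map_smul]; exact hsmul _ _ hp

/-- `S` maps `𝔥⁰` into itself. -/
theorem S_mem_h0 {w : NC K} (hw : w ∈ h0 K) : S w ∈ h0 K := by
  refine h0_induction (P := fun w => S w ∈ h0 K) hw ?_ ?_ ?_ ?_
  · rw [S_one]; exact one_mem_h0
  · intro w
    rw [← mul_assoc, Y, S_mul_letter, map_mul, sigma_X, mul_assoc]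
    exact X_mul_Y_mem_h0 _
  · intro p q hp hq; rw [map_add]; exact add_mem hp hq
  · intro c p hp; rw [map_smul]; exact Submodule.smul_mem _ _ hp

theorem mul_Y_mul_mem {w v : NC K} (hv : v ∈ h1 K) : ∃ u, w * Y K * v = u * Y K := by
  refine h1_induction (P := fun v => ∃ u, w * Y K * v = u * Y K) hv ?_ ?_ ?_ ?_
  · exact ⟨w, by simp⟩
  · intro v; exact ⟨w * Y K * word v, by simp [mul_assoc]⟩
  · intro p q hp hq
    obtain ⟨a, ha⟩ := hp
    obtain ⟨b, hb⟩ := hq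
    exact ⟨a + b, by rw [mul_add, ha, hb, add_mul]⟩
  · intro c p hp
    obtain ⟨a, ha⟩ := hp
    exact ⟨c • a, by rw [mul_smul_comm, ha, smul_mul_assoc]⟩

theorem z_mul_mem_h1 (k : ℕ+) {v : NC K} (hv : v ∈ h1 K) : z K k * v ∈ h1 K := by
  obtain ⟨u, hu⟩ := mul_Y_mul_mem (w := X K ^ ((k : ℕ) - 1)) hv
  rw [z, hu]
  exact mul_Y_mem_h1 u

theorem z_mul_mem_h0 {k : ℕ+} (hk : 2 ≤ k) {v : NC K} (hv : v ∈ h1 K) : z K k * v ∈ h0 K := by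
  obtain ⟨u, hu⟩ := mul_Y_mul_mem (w := X K ^ ((k : ℕ) - 2)) hv
  have hk' : 2 ≤ (k : ℕ) := hk
  have : (k : ℕ) - 1 = (k : ℕ) - 2 + 1 := by omega
  rw [z, this, pow_succ', mul_assoc, mul_assoc, ← mul_assoc _ (Y K) v, hu]
  exact X_mul_Y_mem_h0 u

theorem zWord_mem_h1 (ks : List ℕ+) : zWord K ks ∈ h1 K := by
  induction ks with
  | nil => exact one_mem_h1
  | cons k ks ih => simpa [zWord] using z_mul_mem_h1 k ih

theorem zWord_mem_h0 {ks : List ℕ+} (h : Admissible ks) : zWord K ks ∈ h0 K := by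
  cases ks with
  | nil => exact one_mem_h0
  | cons k ks =>
    have := z_mul_mem_h0 (K := K) (h k (by simp)) (zWord_mem_h1 ks)
    simpa [zWord] using this

theorem stuffleIndex_mem_h1 (ks ls : List ℕ+) : stuffleIndex ks ls ∈ h1 K := by
  induction ks, ls using stuffleIndex.induct with
  | case1 ls => rw [stuffleIndex]; exact zWord_mem_h1 ls
  | case2 k ks => rw [stuffleIndex]; exact zWord_mem_h1 _
  | case3 k ks l ls h1 h2 h3 =>
    rw [stuffleIndex]
    exact add_mem (add_mem (z_mul_mem_h1 _ h1) (z_mul_mem_h1 _ h2)) (z_mul_mem_h1 _ h3)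

theorem stuffleIndex_mem_h0 {ks ls : List ℕ+} (hk : Admissible ks) (hl : Admissible ls) :
    stuffleIndex ks ls ∈ h0 K := by
  rcases ks with _ | ⟨k, ks⟩
  · rw [stuffleIndex]; exact zWord_mem_h0 hl
  · rcases ls with _ | ⟨l, ls⟩
    · rw [stuffleIndex]; exact zWord_mem_h0 hk
    · have hk' : 2 ≤ k := hk k (by simp)
      have hl' : 2 ≤ l := hl l (by simp)
      rw [stuffleIndex]
      exact add_mem (add_mem (z_mul_mem_h0 hk' (stuffleIndex_mem_h1 _ _))
        (z_mul_mem_h0 hl' (stuffleIndex_mem_h1 _ _)))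
        (z_mul_mem_h0 (hk'.trans (PNat.lt_add_right k l).le) (stuffleIndex_mem_h1 _ _))

theorem indexAux_admissible (m : ℕ) (w : List Letter) : Admissible (indexAux (m + 1) w) := by
  induction w generalizing m with
  | nil => simp [indexAux, Admissible]
  | cons a w ih =>
    cases a with
    | x => exact ih (m + 1)
    | y =>
      intro k hk
      simp only [indexAux, List.head?_cons, Option.mem_def, Option.some.injEq] at hk
      subst hk
      rw [← PNat.coe_le_coe]
      simp

theorem indexOf_x_admissible (w : List Letter) : Admissible (indexOf (Letter.x :: w)) :=
  indexAux_admissible 0 w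

theorem X_word_Y (w : List Letter) :
    X K * (word w * Y K) = word (Letter.x :: (w ++ [Letter.y])) := by
  rw [word_cons, word_append]; rfl

/-- `𝔥⁰` is closed under the stuffle product. -/
theorem stuffle_mem_h0 {u v : NC K} (hu : u ∈ h0 K) (hv : v ∈ h0 K) : stuffle u v ∈ h0 K := by
  have hnil : Admissible (indexOf []) := by simp [indexOf, indexAux, Admissible]
  have key : ∀ w w', Admissible (indexOf w) → Admissible (indexOf w') →
      stuffle (word w : NC K) (word w') ∈ h0 K := fun w w' h h' => by
    rw [stuffle, wordLift_word, wordLift_word]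
    exact stuffleIndex_mem_h0 h h'
  have key2 : ∀ w, Admissible (indexOf w) → stuffle (word w : NC K) v ∈ h0 K := fun w h => by
    refine h0_induction (P := fun v => stuffle (word w : NC K) v ∈ h0 K) hv ?_ ?_ ?_ ?_
    · rw [← word_nil]; exact key _ _ h hnil
    · intro w'; rw [X_word_Y]; exact key _ _ h (indexOf_x_admissible _)
    · intro p q hp hq; rw [map_add]; exact add_mem hp hq
    · intro c p hp; rw [map_smul]; exact Submodule.smul_mem _ _ hp
  refine h0_induction (P := fun u => stuffle u v ∈ h0 K) hu ?_ ?_ ?_ ?_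
  · rw [← word_nil]; exact key2 _ hnil
  · intro w'; rw [X_word_Y]; exact key2 _ (indexOf_x_admissible _)
  · intro p q hp hq; rw [map_add]; exact add_mem hp hq
  · intro c p hp; rw [map_smul]; exact Submodule.smul_mem _ _ hp

theorem word_mem_range_Y {w : List Letter} (h : w.getLast? = some Letter.y) :
    (word w : NC K) ∈ LinearMap.range (LinearMap.mulRight K (Y K)) := by
  obtain ⟨u, rfl⟩ := List.getLast?_eq_some_iff.1 h
  exact ⟨word u, by rw [word_append]; rfl⟩

theorem shuffleWord_mem_range_Y (u v : List Letter) (hu : ∀ a ∈ u.getLast?, a = Letter.y)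
    (hv : ∀ a ∈ v.getLast?, a = Letter.y) (huv : u ≠ [] ∨ v ≠ []) :
    (shuffleWord u v : NC K) ∈ LinearMap.range (LinearMap.mulRight K (Y K)) := by
  have last : ∀ w : List Letter, w ≠ [] → (∀ a ∈ w.getLast?, a = Letter.y) →
      w.getLast? = some Letter.y := fun w hw h => by
    rw [List.getLast?_eq_some_getLast hw, h _ (List.getLast?_eq_some_getLast hw)]
  have tail : ∀ (a : Letter) (w : List Letter), (∀ b ∈ (a :: w).getLast?, b = Letter.y) →
      ∀ b ∈ w.getLast?, b = Letter.y := fun a w h b hb => by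
    refine h b ?_
    rw [List.getLast?_cons, Option.mem_def.1 hb]; rfl
  have left : ∀ (w p : NC K), p ∈ LinearMap.range (LinearMap.mulRight K (Y K)) →
      w * p ∈ LinearMap.range (LinearMap.mulRight K (Y K)) := by
    rintro w _ ⟨p, rfl⟩
    exact ⟨w * p, by simp [mul_assoc]⟩
  induction u, v using shuffleWord.induct with
  | case1 v =>
    rw [shuffleWord]
    exact word_mem_range_Y (last v (by simpa using huv) hv)
  | case2 a u =>
    rw [shuffleWord]
    exact word_mem_range_Y (last _ (by simp) hu)
  | case3 a u b v ih1 ih2 =>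
    rw [shuffleWord]
    exact add_mem (left _ _ (ih1 (tail _ _ hu) hv (by simp)))
      (left _ _ (ih2 hu (tail _ _ hv) (by simp)))

theorem shuffleWord_x_mem_h0 (u v : List Letter) :
    (shuffleWord (Letter.x :: (u ++ [Letter.y])) (Letter.x :: (v ++ [Letter.y])) : NC K)
      ∈ h0 K := by
  rw [shuffleWord]
  have left : ∀ p : NC K, p ∈ LinearMap.range (LinearMap.mulRight K (Y K)) →
      word [Letter.x] * p ∈ h0 K := by
    rintro _ ⟨p, rfl⟩
    exact X_mul_Y_mem_h0 p
  refine add_mem (left _ (shuffleWord_mem_range_Y _ _ ?_ ?_ ?_))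
    (left _ (shuffleWord_mem_range_Y _ _ ?_ ?_ ?_)) <;> simp [List.getLast?_cons]

/-- `𝔥⁰` is closed under the shuffle product. -/
theorem shuffle_mem_h0 {u v : NC K} (hu : u ∈ h0 K) (hv : v ∈ h0 K) : shuffle u v ∈ h0 K := by
  have one_left : ∀ w, shuffle (word [] : NC K) (word w) = word w := fun w => by
    rw [shuffle, wordLift_word, wordLift_word, shuffleWord]
  have one_right : ∀ w, shuffle (word w : NC K) (word []) = word w := fun w => by
    rw [shuffle, wordLift_word, wordLift_word]
    cases w <;> rw [shuffleWord]
  have one' : (word [] : NC K) ∈ h0 K := one_mem_h0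
  refine h0_induction (P := fun u => shuffle u v ∈ h0 K) hu ?_ ?_ ?_ ?_
  · refine h0_induction (P := fun v => shuffle (1 : NC K) v ∈ h0 K) hv ?_ ?_ ?_ ?_
    · rw [← word_nil, one_left]; exact one'
    · intro w'; rw [X_word_Y, ← word_nil, one_left, ← X_word_Y]; exact X_mul_Y_mem_h0 _
    · intro p q hp hq; rw [map_add]; exact add_mem hp hq
    · intro c p hp; rw [map_smul]; exact Submodule.smul_mem _ _ hp
  · intro w
    rw [X_word_Y]
    refine h0_induction (P := fun v => shuffle (word (Letter.x :: (w ++ [Letter.y])) : NC K) v ∈ h0 K) hv ?_ ?_ ?_ ?_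
    · rw [← word_nil, one_right, ← X_word_Y]; exact X_mul_Y_mem_h0 _
    · intro w'
      rw [X_word_Y, shuffle, wordLift_word, wordLift_word]
      exact shuffleWord_x_mem_h0 w w'
    · intro p q hp hq; rw [map_add]; exact add_mem hp hq
    · intro c p hp; rw [map_smul]; exact Submodule.smul_mem _ _ hp
  · intro p q hp hq; rw [map_add]; exact add_mem hp hq
  · intro c p hp; rw [map_smul]; exact Submodule.smul_mem _ _ hp

/-- The unit of `𝔥⁰`. -/
def one0 : h0 K := ⟨1, one_mem_h0⟩

/-- The shuffle product on `𝔥⁰`. -/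
def shuffle0 (u v : h0 K) : h0 K := ⟨shuffle (u : NC K) v, shuffle_mem_h0 u.2 v.2⟩

/-- The stuffle product on `𝔥⁰`. -/
def stuffle0 (u v : h0 K) : h0 K := ⟨stuffle (u : NC K) v, stuffle_mem_h0 u.2 v.2⟩

/-- The restriction of `S` to `𝔥⁰`. -/
def S0 : h0 K →ₗ[K] h0 K := S.restrict fun _ hw => S_mem_h0 hw

/-! ### The regularized double shuffle relations -/

/-- `reg_⧢(w) = r`: there is a decomposition `w = ∑_i w_i ⧢ y^{⧢ i}` with all `w_i ∈ 𝔥⁰` and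
`w_0 = r`. (The decomposition of an element of `𝔥¹` exists and is unique, since
`𝔥¹_⧢ = 𝔥⁰_⧢[y]` is a polynomial algebra.) -/
def IsShuffleReg (w : NC K) (r : h0 K) : Prop :=
  ∃ c : ℕ →₀ h0 K,
    w = c.sum (fun i wi => shuffle (wi : NC K) (shufflePow (Y K) i)) ∧ c 0 = r

variable {R : Type*} [CommRing R] [Algebra K R]

/-- The (finite) double shuffle relations, with the normalization `Z_R(1) = 1`. -/
def DoubleShuffle (Z : h0 K →ₗ[K] R) : Prop :=
  Z one0 = 1 ∧
    ∀ u v : h0 K, Z (shuffle0 u v) = Z u * Z v ∧ Z (stuffle0 u v) = Z u * Z v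

/-- The regularized double shuffle relations: the double shuffle relations together with
`Z_R(reg_⧢(w₁ ⧢ w₀ - w₁ * w₀)) = 0` for all `w₁ ∈ 𝔥¹` and `w₀ ∈ 𝔥⁰`. -/
def RegularizedDoubleShuffle (Z : h0 K →ₗ[K] R) : Prop :=
  DoubleShuffle Z ∧
    ∀ w₁ ∈ h1 K, ∀ w₀ ∈ h0 K, ∀ r : h0 K,
      IsShuffleReg (shuffle w₁ w₀ - stuffle w₁ w₀) r → Z r = 0

/-- `ζ_R(k_1, …, k_n) = Z_R(z_{k_1} ⋯ z_{k_n})` for an admissible index. -/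
def zeta (Z : h0 K →ₗ[K] R) (ks : List ℕ+) (h : Admissible ks) : R :=
  Z ⟨zWord K ks, zWord_mem_h0 h⟩

/-- `ζ_R^⋆(k_1, …, k_n) = Z_R(S(z_{k_1} ⋯ z_{k_n}))` for an admissible index. -/
def zetaStar (Z : h0 K →ₗ[K] R) (ks : List ℕ+) (h : Admissible ks) : R :=
  Z (S0 ⟨zWord K ks, zWord_mem_h0 h⟩)

end Algebra

theorem admissible_replicate (k : ℕ+) (hk : 2 ≤ k) (n : ℕ) :
    Admissible (List.replicate n k) := by
  intro a ha
  have : a ∈ List.replicate n k := List.mem_of_mem_head? ha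
  rw [List.eq_of_mem_replicate this]
  exact hk

theorem two_le_two_mul (k : ℕ+) : 2 ≤ 2 * k := by
  have := k.pos
  rw [← PNat.coe_le_coe, PNat.mul_coe]
  change 2 ≤ 2 * (k : ℕ)
  omega

/-- The index `{2k}^n` is admissible. -/
theorem admissible_even (k : ℕ+) (n : ℕ) : Admissible (List.replicate n (2 * k)) :=
  admissible_replicate _ (two_le_two_mul k) n

/-! ### The power series of the formula -/

section Series

open PowerSeries

variable (A : Type*) [CommRing A] [Algebra ℚ A]

/-- The power series `e^{s/2} - e^{-s/2}` in `s`. -/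
def expDiff : A⟦X⟧ :=
  rescale (algebraMap ℚ A (1 / 2)) (exp A) - rescale (algebraMap ℚ A (-1 / 2)) (exp A)

/-- The power series `(e^{s/2} - e^{-s/2}) / s` in `s`; see `X_mul_expQuot`.
Its rescaling by `c` is `(e^{ct/2} - e^{-ct/2}) / (ct)`, see `C_mul_X_mul_rescale_expQuot`. -/
def expQuot : A⟦X⟧ := PowerSeries.mk fun n => coeff (n + 1) (expDiff A)

/-- The power series `s / (e^{s/2} - e^{-s/2})` in `s`; see `expQuotInv_mul_expDiff`. -/
def expQuotInv : A⟦X⟧ := invOfUnit (expQuot A) 1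

theorem X_mul_expQuot : PowerSeries.X * expQuot A = expDiff A := by
  ext n
  cases n with
  | zero =>
    rw [coeff_zero_X_mul, expDiff, map_sub, coeff_rescale, coeff_rescale, pow_zero, pow_zero,
      sub_self]
  | succ n => rw [coeff_succ_X_mul, expQuot, coeff_mk]

theorem expQuot_mul_expQuotInv : expQuot A * expQuotInv A = 1 := by
  refine mul_invOfUnit _ _ ?_
  rw [← coeff_zero_eq_constantCoeff_apply, expQuot, coeff_mk, expDiff, map_sub, coeff_rescale,
    coeff_rescale, coeff_exp]
  simp only [zero_add, pow_one, ← map_mul, ← map_sub, Units.val_one]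
  norm_num

theorem C_mul_X_mul_rescale_expQuot (c : A) :
    PowerSeries.C c * PowerSeries.X * rescale c (expQuot A) =
      rescale (algebraMap ℚ A (1 / 2) * c) (exp A)
        - rescale (algebraMap ℚ A (-1 / 2) * c) (exp A) := by
  rw [← rescale_X, ← map_mul, X_mul_expQuot, expDiff, map_sub, rescale_rescale, rescale_rescale]

theorem expQuotInv_mul_expDiff : expQuotInv A * expDiff A = PowerSeries.X := by
  rw [← X_mul_expQuot, mul_left_comm, mul_comm (expQuotInv A), expQuot_mul_expQuotInv, mul_one]

end Series

/-- `ρ_k = e^{π√-1/k}`, in the field `ℚ(ρ_k) = ℚ[ρ_k]`. -/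
def rho (k : ℕ+) : Algebra.adjoin ℚ {Complex.exp (Real.pi * Complex.I / (k : ℂ))} :=
  ⟨Complex.exp (Real.pi * Complex.I / (k : ℂ)), Algebra.self_mem_adjoin_singleton ℚ _⟩

end MZV

end

noncomputable section

namespace MZV

/-! ### Stuffle identities for powers of a single letter `z_s`. -/

section Words

variable {K : Type*} [Field K]

/-! Let `T` be an additive extension of `Z` to `𝔥`, with values in `A`. For `s ≥ 2` put `E_s(u) = ∑
(-1)^n T(z_s^n) u^n` and `P_s(u) = ∑ T(z_{(n+1)s}) u^n`. In the stuffle algebra, `z_s^n` and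
`z_{ns}` behave like elementary symmetric functions and power sums, while `S(z_s^n)` behaves like a
complete homogeneous symmetric function. Hence `E_s' = -P_s E_s` (`derivative_elemSeries`), and the
star series is the inverse of `E_s` (`elemSeries_mul_starSeries`). So the second formula follows
from the first.

For `s = 2`, comparing shuffle and stuffle in depth two gives the sum formula and an alternating
companion. Together they yield Euler's recursion `2 ∑ ζ(2i+2) ζ(2m-2i+2) = (2m+5) ζ(2m+4)`
(`euler_recursion`). This is a Riccati equation for `P_2`, which `E_2' = -P_2 E_2` linearizes to
`2uE'' + 3E' + 3ζ(2)E = 0`. Its solution has coefficients `(-6ζ(2))^n / (2n+1)!`, so `E_2(t²)` is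
`expQuot` at `λt` when `λ² = -24ζ(2)`. This is the case `k = 1`.

For general `k`, formally `E_2(u) = ∏ (1 - a u)` and `E_{2k}(u) = ∏ (1 - a^k u)`, so `∏_j E_2(w^j u)
= E_{2k}(u^k)` with `w = ρ_k²` a primitive `k`-th root of unity. The proof compares logarithmic
derivatives (`prod_rescale_eq_expand`), which needs only the power sums `T(z_{2n})`. -/

theorem zWord_cons (k : ℕ+) (ks : List ℕ+) : zWord K (k :: ks) = z K k * zWord K ks := by
  simp [zWord]

theorem zWord_nil : zWord K [] = 1 := rfl

theorem zWord_singleton (k : ℕ+) : zWord K [k] = z K k := by simp [zWord]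

theorem stuffleIndex_nil_left (ls : List ℕ+) : (stuffleIndex [] ls : NC K) = zWord K ls := by
  rw [stuffleIndex]

theorem stuffleIndex_nil_right (ks : List ℕ+) : (stuffleIndex ks [] : NC K) = zWord K ks := by
  cases ks <;> rw [stuffleIndex]

theorem stuffleIndex_cons_cons (k l : ℕ+) (ks ls : List ℕ+) :
    (stuffleIndex (k :: ks) (l :: ls) : NC K) =
      z K k * stuffleIndex ks (l :: ls) + z K l * stuffleIndex (k :: ks) ls
        + z K (k + l) * stuffleIndex ks ls := by
  rw [stuffleIndex]

theorem succPNat_mul_add (c : ℕ) (s : ℕ+) : c.succPNat * s + s = (c + 1).succPNat * s := by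
  apply PNat.eq
  simp only [PNat.add_coe, PNat.mul_coe, Nat.succPNat_coe, Nat.succ_eq_add_one]
  ring

theorem zero_succPNat_mul (s : ℕ+) : (0 : ℕ).succPNat * s = s := by
  apply PNat.eq
  simp

theorem two_le_succPNat_mul (c : ℕ) {s : ℕ+} (hs : 2 ≤ s) : 2 ≤ c.succPNat * s :=
  hs.trans (le_mul_of_one_le_left' one_le)

theorem admissible_singleton {k : ℕ+} (hk : 2 ≤ k) : Admissible [k] := by
  simpa [Admissible] using hk

/-! ### The stuffle product of a letter and a power of a letter -/

variable (K) in
/-- The sum of the words obtained by inserting `z_c` into `z_s^n`. -/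
def insertSum (c s : ℕ+) : ℕ → NC K
  | 0 => z K c
  | n + 1 => z K c * zWord K (List.replicate (n + 1) s) + z K s * insertSum c s n

theorem insertSum_succ (c s : ℕ+) (n : ℕ) : insertSum K c s (n + 1) =
    z K c * zWord K (List.replicate (n + 1) s) + z K s * insertSum K c s n := rfl

theorem insertSum_self (s : ℕ+) (n : ℕ) :
    insertSum K s s n = (n + 1) • zWord K (List.replicate (n + 1) s) := by
  induction n with
  | zero => simp [insertSum, zWord]
  | succ n ih =>
    rw [insertSum, ih, List.replicate_succ (n := n + 1), zWord_cons, mul_smul_comm]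
    module

/-- The letter `z_c` is either inserted into the power of `z_s` or merged with one of its letters,
which becomes `z_{c+s}`. -/
theorem stuffleIndex_singleton_replicate (c s : ℕ+) (n : ℕ) :
    (stuffleIndex [c] (List.replicate (n + 1) s) : NC K) =
      insertSum K c s (n + 1) + insertSum K (c + s) s n := by
  induction n with
  | zero =>
    simp only [List.replicate, zero_add]
    rw [stuffleIndex_cons_cons, stuffleIndex_nil_left, stuffleIndex_nil_right,
      stuffleIndex_nil_right]
    simp [insertSum, zWord]
  | succ n ih =>
    rw [List.replicate_succ, stuffleIndex_cons_cons, ih, stuffleIndex_nil_left,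
      stuffleIndex_nil_left, ← List.replicate_succ, insertSum_succ c s (n + 1),
      insertSum_succ (c + s) s n]
    rw [mul_add]
    abel

/-! ### The stuffle product of `z_s^i` and `S(z_s^j)` -/

theorem X_pow_mul_z (s : ℕ+) (c : ℕ) :
    X K ^ (s : ℕ) * z K (c.succPNat * s) = z K ((c + 1).succPNat * s) := by
  rw [z, z, ← mul_assoc, ← pow_add]
  congr 2
  have := s.pos
  have h : 0 < (c + 1) * (s : ℕ) := by positivity
  simp only [PNat.mul_coe, Nat.succPNat_coe, Nat.succ_eq_add_one, add_mul, one_mul] at h ⊢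
  omega

theorem sigma_z (s : ℕ+) : sigma (z K s) = X K ^ (s : ℕ) + z K s := by
  have h : (s : ℕ) = (s : ℕ) - 1 + 1 := by have := s.pos; omega
  conv_rhs => rw [h, pow_succ]
  rw [z, map_mul, map_pow, sigma_X, sigma_Y, mul_add]

theorem S_mul_z (w : NC K) (s : ℕ+) : S (w * z K s) = sigma w * z K s := by
  rw [z, ← mul_assoc, Y, S_mul_letter, map_mul, map_pow, sigma_X, mul_assoc]

theorem S_replicate_one (s : ℕ+) : S (zWord K (List.replicate 1 s)) = z K s := by
  have := S_mul_z (1 : NC K) s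
  simpa [zWord] using this

theorem S_replicate_succ_succ (s : ℕ+) (n : ℕ) :
    S (zWord K (List.replicate (n + 2) s)) =
      (X K ^ (s : ℕ) + z K s) * S (zWord K (List.replicate (n + 1) s)) := by
  have h : ∀ m, zWord K (List.replicate (m + 1) s) = z K s ^ m * z K s := fun m => by
    rw [zWord, List.map_replicate, List.prod_replicate, pow_succ]
  rw [h, h, S_mul_z, S_mul_z, pow_succ', map_mul, sigma_z, mul_assoc]

/-- Each `y` except the last may turn into `x`, gluing neighbouring letters `z_s`. The terms are
sorted by the number `c + 1` of letters glued into the first block. -/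
theorem S_replicate_succ (s : ℕ+) (n : ℕ) :
    S (zWord K (List.replicate (n + 1) s)) =
      ∑ c ∈ Finset.range (n + 1),
        z K (c.succPNat * s) * S (zWord K (List.replicate (n - c) s)) := by
  induction n with
  | zero =>
    rw [zero_add, S_replicate_one]
    simp [zWord_nil, S_one, zero_succPNat_mul]
  | succ n ih =>
    rw [S_replicate_succ_succ, add_mul, Finset.sum_range_succ', zero_succPNat_mul]
    congr 1
    rw [ih, Finset.mul_sum]
    refine Finset.sum_congr rfl fun c _ => ?_
    rw [← mul_assoc, X_pow_mul_z, Nat.add_sub_add_right]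

/-- The stuffle recursion is known on the words `zWord`; membership in their span lets it be applied
to `S(z_s^n)` by linearity. -/
theorem S_replicate_mem_span (s : ℕ+) (n : ℕ) :
    S (zWord K (List.replicate n s)) ∈ Submodule.span K (Set.range (zWord K)) := by
  induction n using Nat.strong_induction_on with
  | _ n ih =>
    rcases n with _ | n
    · rw [List.replicate_zero, zWord_nil, S_one]
      exact Submodule.subset_span ⟨[], rfl⟩
    · rw [S_replicate_succ]
      refine Submodule.sum_mem _ fun c _ => ?_
      have hc := ih (n - c) (by omega)
      generalize S (zWord K (List.replicate (n - c) s)) = v at hc ⊢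
      induction hc using Submodule.span_induction with
      | mem _ h =>
        obtain ⟨ls, rfl⟩ := h
        exact Submodule.subset_span ⟨_ :: ls, zWord_cons _ _⟩
      | zero => rw [mul_zero]; exact zero_mem _
      | add _ _ _ _ hu hv => rw [mul_add]; exact add_mem hu hv
      | smul a _ _ hu => rw [mul_smul_comm]; exact Submodule.smul_mem _ _ hu

theorem stuffle_one_left {v : NC K} (hv : v ∈ Submodule.span K (Set.range (zWord K))) :
    stuffle 1 v = v := by
  induction hv using Submodule.span_induction with
  | mem _ h =>
    obtain ⟨ls, rfl⟩ := h
    rw [← zWord_nil, stuffle_zWord, stuffleIndex_nil_left]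
  | zero => rw [map_zero]
  | add _ _ _ _ hu hv => rw [map_add, hu, hv]
  | smul a _ _ hu => rw [map_smul, hu]

theorem stuffle_zWord_one (ks : List ℕ+) : stuffle (zWord K ks) 1 = zWord K ks := by
  rw [← zWord_nil, stuffle_zWord, stuffleIndex_nil_right]

theorem stuffle_cons_z_mul (k l : ℕ+) (ks : List ℕ+) {v : NC K}
    (hv : v ∈ Submodule.span K (Set.range (zWord K))) :
    stuffle (zWord K (k :: ks)) (z K l * v) =
      z K k * stuffle (zWord K ks) (z K l * v) + z K l * stuffle (zWord K (k :: ks)) v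
        + z K (l + k) * stuffle (zWord K ks) v := by
  induction hv using Submodule.span_induction with
  | mem _ h =>
    obtain ⟨ls, rfl⟩ := h
    rw [← zWord_cons, stuffle_zWord, stuffle_zWord, stuffle_zWord, stuffle_zWord,
      stuffleIndex_cons_cons, add_comm l k]
  | zero => simp
  | add _ _ _ _ hu hv => simp only [mul_add, map_add, hu, hv]; abel
  | smul a _ _ hu => simp only [mul_smul_comm, map_smul, hu, smul_add]

variable (K) in
/-- The part of `z_s^i * S(z_s^j)` in which the first letter comes from `S(z_s^j)` alone. -/
def stuffleStarPart (s : ℕ+) (i j : ℕ) : NC K :=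
  ∑ c ∈ Finset.range j, z K (c.succPNat * s) *
    stuffle (zWord K (List.replicate i s)) (S (zWord K (List.replicate (j - 1 - c) s)))

theorem stuffle_zero_S_replicate (s : ℕ+) (j : ℕ) :
    stuffle (zWord K (List.replicate 0 s)) (S (zWord K (List.replicate (j + 1) s))) =
      stuffleStarPart K s 0 (j + 1) := by
  rw [List.replicate_zero, zWord_nil, stuffle_one_left (S_replicate_mem_span s _),
    S_replicate_succ, stuffleStarPart]
  refine Finset.sum_congr rfl fun c _ => ?_
  rw [List.replicate_zero, zWord_nil, stuffle_one_left (S_replicate_mem_span s _),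
    Nat.add_sub_cancel]

/-- The first letter comes from the star factor alone, from `z_s` alone, or from merging `z_s` with
a first block `z_{(c+1)s}`. The last two cases are the blocks of length `1` and `c + 2` in
`stuffleStarPart` at `(i, j + 1)`, so the alternating sum telescopes. -/
theorem stuffle_succ_S_replicate (s : ℕ+) (i j : ℕ) :
    stuffle (zWord K (List.replicate (i + 1) s)) (S (zWord K (List.replicate j s))) =
      stuffleStarPart K s (i + 1) j + stuffleStarPart K s i (j + 1) := by
  have hB : stuffleStarPart K s i (j + 1) =
      ∑ c ∈ Finset.range j, z K ((c + 1).succPNat * s) *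
        stuffle (zWord K (List.replicate i s)) (S (zWord K (List.replicate (j - 1 - c) s))) +
      z K s * stuffle (zWord K (List.replicate i s)) (S (zWord K (List.replicate j s))) := by
    rw [stuffleStarPart, Finset.sum_range_succ', zero_succPNat_mul]
    congr 1
    refine Finset.sum_congr rfl fun c _ => ?_
    rw [Nat.add_sub_cancel, Nat.sub_sub, add_comm c 1]
  rw [hB, stuffleStarPart]
  rcases j with _ | j
  · simp only [List.replicate_zero, zWord_nil, S_one, stuffle_zWord_one, Finset.range_zero,
      Finset.sum_empty, zero_add]
    rw [← zWord_cons, List.replicate_succ]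
  · conv_lhs => rw [S_replicate_succ, map_sum, List.replicate_succ]
    rw [Finset.sum_congr rfl fun c _ =>
      stuffle_cons_z_mul s (c.succPNat * s) (List.replicate i s) (S_replicate_mem_span s (j - c))]
    rw [Finset.sum_add_distrib, Finset.sum_add_distrib, ← Finset.mul_sum, ← map_sum,
      ← S_replicate_succ, ← List.replicate_succ]
    simp only [succPNat_mul_add, Nat.add_sub_cancel]
    abel

/-- The signed sum of the stuffle products `z_s^i * S(z_s^j)` with `i + j = n > 0` vanishes. -/
theorem sum_stuffle_S_replicate (s : ℕ+) (n : ℕ) :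
    ∑ i ∈ Finset.range (n + 2), (-1 : ℤ) ^ i •
      stuffle (zWord K (List.replicate i s)) (S (zWord K (List.replicate (n + 1 - i) s))) = 0 := by
  -- Partial sums telescope to the last star part, which is an empty sum at `m = n + 1`.
  have key : ∀ m ≤ n + 1, ∑ i ∈ Finset.range (m + 1), (-1 : ℤ) ^ i •
      stuffle (zWord K (List.replicate i s)) (S (zWord K (List.replicate (n + 1 - i) s))) =
      (-1 : ℤ) ^ m • stuffleStarPart K s m (n + 1 - m) := by
    intro m
    induction m with
    | zero => intro _; simpa using stuffle_zero_S_replicate s n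
    | succ m ih =>
      intro hm
      rw [Finset.sum_range_succ, ih (by omega), stuffle_succ_S_replicate,
        show n + 1 - (m + 1) + 1 = n + 1 - m by omega, pow_succ]
      module
  rw [key (n + 1) le_rfl, Nat.sub_self, stuffleStarPart, Finset.range_zero, Finset.sum_empty,
    smul_zero]

end Words

/-! ### Generating series -/

section Generating

open PowerSeries

variable {K A : Type*} [Field K] [CommRing A] (T : NC K →+ A) (s : ℕ+)

/-- The series `∑ (-1)^n T(z_s^n) u^n`. -/
def elemSeries : A⟦X⟧ := PowerSeries.mk fun n => (-1) ^ n * T (zWord K (List.replicate n s))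

/-- The series `∑ T(S(z_s^n)) u^n`. -/
def starSeries : A⟦X⟧ := PowerSeries.mk fun n => T (S (zWord K (List.replicate n s)))

/-- The series `∑ T(z_{(n+1)s}) u^n`. -/
def powerSumSeries : A⟦X⟧ := PowerSeries.mk fun n => T (z K (n.succPNat * s))

variable {T s}

/-- Each product is a sum of an insertion term and a merging term; the merging term cancels the
insertion term of the preceding summand. What remains is `z_s` inserted into `z_s^n`, which gives
`z_s^{n+1}` with multiplicity `n + 1`. -/
theorem sum_powerSum_mul_elem (hs : 2 ≤ s) (hT1 : T 1 = 1)
    (hT : ∀ u ∈ h0 K, ∀ v ∈ h0 K, T (stuffle u v) = T u * T v) (n : ℕ) :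
    ∑ d ∈ Finset.range (n + 1), (-1) ^ d * T (zWord K (List.replicate d s)) *
      T (z K ((n - d).succPNat * s)) =
      (-1) ^ n * (n + 1) * T (zWord K (List.replicate (n + 1) s)) := by
  have hmul : ∀ c d : ℕ, T (zWord K (List.replicate (d + 1) s)) * T (z K (c.succPNat * s)) =
      T (insertSum K (c.succPNat * s) s (d + 1)) + T (insertSum K ((c + 1).succPNat * s) s d) := by
    intro c d
    rw [← succPNat_mul_add, ← map_add, ← stuffleIndex_singleton_replicate, ← stuffle_zWord,
      hT _ (zWord_mem_h0 (admissible_singleton (two_le_succPNat_mul c hs))) _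
        (zWord_mem_h0 (admissible_replicate s hs _)), zWord_singleton, mul_comm]
  have key : ∀ m ≤ n, ∑ d ∈ Finset.range (m + 1), (-1) ^ d *
      T (zWord K (List.replicate d s)) * T (z K ((n - d).succPNat * s)) =
      (-1) ^ m * T (insertSum K ((n - m).succPNat * s) s m) := by
    intro m
    induction m with
    | zero => intro _; simp [zWord_nil, hT1, insertSum]
    | succ m ih =>
      intro hm
      rw [Finset.sum_range_succ, ih (by omega), mul_assoc, hmul,
        show n - (m + 1) + 1 = n - m by omega, pow_succ]
      ring
  rw [key n le_rfl, Nat.sub_self, zero_succPNat_mul, insertSum_self, map_nsmul, nsmul_eq_mul]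
  push_cast
  ring

/-- Newton's identities. -/
theorem derivative_elemSeries (hs : 2 ≤ s) (hT1 : T 1 = 1)
    (hT : ∀ u ∈ h0 K, ∀ v ∈ h0 K, T (stuffle u v) = T u * T v) :
    d⁄dX A (elemSeries T s) = -powerSumSeries T s * elemSeries T s := by
  ext n
  rw [coeff_derivative, neg_mul, map_neg, mul_comm (powerSumSeries T s), coeff_mul,
    Finset.Nat.sum_antidiagonal_eq_sum_range_succ
      (fun i j => coeff i (elemSeries T s) * coeff j (powerSumSeries T s))]
  simp only [elemSeries, powerSumSeries, coeff_mk, Nat.succ_eq_add_one]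
  rw [sum_powerSum_mul_elem hs hT1 hT]
  ring

theorem constantCoeff_elemSeries (hT1 : T 1 = 1) : constantCoeff (elemSeries T s) = 1 := by
  rw [← coeff_zero_eq_constantCoeff_apply, elemSeries, coeff_mk]
  simp [zWord_nil, hT1]

theorem elemSeries_mul_starSeries (hs : 2 ≤ s) (hT1 : T 1 = 1)
    (hT : ∀ u ∈ h0 K, ∀ v ∈ h0 K, T (stuffle u v) = T u * T v) :
    elemSeries T s * starSeries T s = 1 := by
  ext n
  rw [coeff_mul, Finset.Nat.sum_antidiagonal_eq_sum_range_succ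
      (fun i j => coeff i (elemSeries T s) * coeff j (starSeries T s))]
  simp only [elemSeries, starSeries, coeff_mk, Nat.succ_eq_add_one]
  rcases n with _ | n
  · simp [zWord_nil, S_one, hT1]
  · rw [coeff_one, if_neg n.succ_ne_zero, ← map_zero T, ← sum_stuffle_S_replicate s n, map_sum]
    refine Finset.sum_congr rfl fun i _ => ?_
    rw [map_zsmul, hT _ (zWord_mem_h0 (admissible_replicate s hs _)) _
      (S_mem_h0 (zWord_mem_h0 (admissible_replicate s hs _)))]
    simp [mul_assoc]

end Generating

/-! ### Shuffle and stuffle products of two letters `z_k`. -/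

section DepthTwo

variable {K : Type*} [Field K]

/-- The word `x^n y`. -/
def depthOneWord (n : ℕ) : List Letter := List.replicate n Letter.x ++ [Letter.y]

theorem word_depthOneWord (n : ℕ) : (word (depthOneWord n) : NC K) = z K n.succPNat := by
  rw [← zWord_singleton, zWord_eq_word]
  simp [depthOneWord]

variable (K) in
/-- The shuffle product of `z_{a+1}` and `z_{b+1}`. -/
def depthOneShuffle (a b : ℕ) : NC K := shuffleWord (depthOneWord a) (depthOneWord b)

theorem shuffle_z (a b : ℕ) :
    shuffle (z K a.succPNat) (z K b.succPNat) = depthOneShuffle K a b := by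
  rw [← word_depthOneWord, ← word_depthOneWord, shuffle, wordLift_word, wordLift_word,
    depthOneShuffle]

theorem depthOneWord_succ (n : ℕ) : depthOneWord (n + 1) = Letter.x :: depthOneWord n := rfl

theorem depthOneWord_zero : depthOneWord 0 = [Letter.y] := rfl

theorem X_mul_z (n : ℕ) : X K * z K n.succPNat = z K (n + 1).succPNat := by
  rw [← word_depthOneWord, ← word_depthOneWord, depthOneWord_succ, word_cons, X]

theorem z_zero_succPNat : z K (0 : ℕ).succPNat = Y K := by simp [z]

theorem shuffleWord_nil_right (u : List Letter) : (shuffleWord u [] : NC K) = word u := by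
  cases u <;> rw [shuffleWord]

theorem depthOneShuffle_succ_succ (a b : ℕ) : depthOneShuffle K (a + 1) (b + 1) =
    X K * depthOneShuffle K a (b + 1) + X K * depthOneShuffle K (a + 1) b := by
  rw [depthOneShuffle, depthOneWord_succ, depthOneWord_succ, shuffleWord]
  rfl

theorem depthOneShuffle_zero_succ (b : ℕ) : depthOneShuffle K 0 (b + 1) =
    Y K * z K (b + 1).succPNat + X K * depthOneShuffle K 0 b := by
  rw [← word_depthOneWord, depthOneShuffle, depthOneWord_succ, depthOneWord_zero, shuffleWord,
    shuffleWord]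
  rfl

theorem depthOneShuffle_succ_zero (a : ℕ) : depthOneShuffle K (a + 1) 0 =
    X K * depthOneShuffle K a 0 + Y K * z K (a + 1).succPNat := by
  rw [← word_depthOneWord, depthOneShuffle, depthOneWord_succ, depthOneWord_zero, shuffleWord,
    shuffleWord_nil_right]
  rfl

theorem depthOneShuffle_zero_zero : depthOneShuffle K 0 0 = Y K * Y K + Y K * Y K := by
  rw [depthOneShuffle, depthOneWord_zero, shuffleWord, shuffleWord, shuffleWord_nil_right, Y]

/-- The letter `y` is inserted into `x^n y` at each place before the final `y`. The place just
before it and the place just after it give the same word, hence the extra term. -/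
theorem depthOneShuffle_zero_left (n : ℕ) : depthOneShuffle K 0 n =
    ∑ a ∈ Finset.range (n + 1), z K a.succPNat * z K (n - a).succPNat +
      z K n.succPNat * z K (0 : ℕ).succPNat := by
  induction n with
  | zero => simp [depthOneShuffle_zero_zero, z_zero_succPNat]
  | succ n ih =>
    rw [depthOneShuffle_zero_succ, ih, Finset.sum_range_succ' _ (n + 1), mul_add, ← mul_assoc (X K),
      X_mul_z, Finset.mul_sum]
    simp only [← mul_assoc (X K), X_mul_z, Nat.add_sub_add_right, z_zero_succPNat, Nat.sub_zero]
    abel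

theorem depthOneShuffle_zero_comm (n : ℕ) : depthOneShuffle K n 0 = depthOneShuffle K 0 n := by
  induction n with
  | zero => rfl
  | succ n ih => rw [depthOneShuffle_succ_zero, depthOneShuffle_zero_succ, ih, add_comm]

/-- The signed sum of the shuffle products `x^a y ⧢ x^b y` with `a + b = n > 0`. -/
theorem sum_depthOneShuffle (n : ℕ) :
    ∑ a ∈ Finset.range (n + 2), (-1 : ℤ) ^ a • depthOneShuffle K a (n + 1 - a) =
      (1 + (-1 : ℤ) ^ (n + 1)) • (Y K * z K (n + 1).succPNat) := by
  -- Terms starting with `x` occur in two neighbouring summands with opposite signs. Only the words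
  -- starting with `y`, from the two ends of the sum, survive.
  have key : ∀ m ≤ n,
      ∑ a ∈ Finset.range (m + 1), (-1 : ℤ) ^ a • depthOneShuffle K a (n + 1 - a) =
        Y K * z K (n + 1).succPNat + (-1 : ℤ) ^ m • (X K * depthOneShuffle K m (n - m)) := by
    intro m
    induction m with
    | zero => intro _; simp [depthOneShuffle_zero_succ]
    | succ m ih =>
      intro hm
      rw [Finset.sum_range_succ, ih (by omega), show n + 1 - (m + 1) = n - (m + 1) + 1 by omega,
        depthOneShuffle_succ_succ, show n - (m + 1) + 1 = n - m by omega, pow_succ]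
      module
  rw [Finset.sum_range_succ, key n le_rfl, Nat.sub_self, Nat.sub_self, depthOneShuffle_succ_zero,
    pow_succ]
  module

theorem stuffle_z (k l : ℕ+) : stuffle (z K k) (z K l) =
    z K k * z K l + z K l * z K k + z K (k + l) := by
  rw [← zWord_singleton, ← zWord_singleton, stuffle_zWord, stuffleIndex_cons_cons,
    stuffleIndex_nil_left, stuffleIndex_nil_right, stuffleIndex_nil_left, zWord_singleton,
    zWord_singleton, zWord_nil, mul_one]

theorem succPNat_add_succPNat (a b : ℕ) :
    a.succPNat + b.succPNat = (a + b + 1).succPNat := by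
  apply PNat.eq
  simp only [PNat.add_coe, Nat.succPNat_coe]
  omega

theorem z_succ_succ_mem_h0 (n : ℕ) : z K (n + 1).succPNat ∈ h0 K := by
  rw [← zWord_singleton]
  refine zWord_mem_h0 (admissible_singleton ?_)
  rw [← PNat.coe_le_coe]
  simp

/-- The non-admissible word `z_1 z_{n+1}` cancels, so for `n > 0` the difference lies in `𝔥⁰`.
Applying `T` then gives the sum formula in depth two. -/
theorem shuffle_sub_stuffle_z_one (n : ℕ) :
    shuffle (z K (0 : ℕ).succPNat) (z K n.succPNat) -
      stuffle (z K (0 : ℕ).succPNat) (z K n.succPNat) =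
    ∑ a ∈ Finset.range n, z K (a + 1).succPNat * z K (n - (a + 1)).succPNat -
      z K (n + 1).succPNat := by
  rw [shuffle_z, stuffle_z, depthOneShuffle_zero_left, Finset.sum_range_succ',
    succPNat_add_succPNat, zero_add, Nat.sub_zero]
  abel

end DepthTwo

/-! ### Euler's recursion from the double shuffle relations in depth two. -/

section Euler

variable {K A : Type*} [Field K] [CommRing A] {T : NC K →+ A}

theorem sum_range_one_sub_neg_one_pow_mul (g : ℕ → A) (m : ℕ) :
    ∑ a ∈ Finset.range (2 * m + 1), (1 - (-1) ^ a) * g a =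
      2 * ∑ i ∈ Finset.range m, g (2 * i + 1) := by
  induction m with
  | zero => simp
  | succ m ih =>
    rw [show 2 * (m + 1) + 1 = 2 * m + 1 + 1 + 1 by ring, Finset.sum_range_succ,
      Finset.sum_range_succ, ih, Finset.sum_range_succ]
    simp only [pow_succ, pow_mul]
    ring

/-- The difference of the shuffle and the stuffle product of `z_{a+1}` and `z_{b+1}` is killed. -/
theorem map_shuffle_z_sub_stuffle_z
    (hT : ∀ u ∈ h0 K, ∀ v ∈ h0 K, T (shuffle u v) = T (stuffle u v))
    (hreg : ∀ w₁ ∈ h1 K, ∀ w₀ ∈ h0 K,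
      shuffle w₁ w₀ - stuffle w₁ w₀ ∈ h0 K → T (shuffle w₁ w₀ - stuffle w₁ w₀) = 0)
    (a b : ℕ) (hab : a + b ≠ 0) :
    T (shuffle (z K a.succPNat) (z K b.succPNat) -
      stuffle (z K a.succPNat) (z K b.succPNat)) = 0 := by
  have hzero : ∀ n, T (shuffle (z K (0 : ℕ).succPNat) (z K (n + 1).succPNat) -
      stuffle (z K (0 : ℕ).succPNat) (z K (n + 1).succPNat)) = 0 := by
    intro n
    refine hreg _ ?_ _ (z_succ_succ_mem_h0 n) ?_
    · rw [← zWord_singleton]; exact zWord_mem_h1 _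
    · rw [shuffle_sub_stuffle_z_one]
      refine sub_mem (Submodule.sum_mem _ fun a _ => ?_) (z_succ_succ_mem_h0 _)
      refine z_mul_mem_h0 ?_ ?_
      · rw [← PNat.coe_le_coe]; simp
      · rw [← zWord_singleton]; exact zWord_mem_h1 _
  rcases a with _ | a
  · obtain ⟨b, rfl⟩ := Nat.exists_eq_succ_of_ne_zero (by simpa using hab)
    exact hzero b
  · rcases b with _ | b
    · rw [shuffle_z, stuffle_z, depthOneShuffle_zero_comm, ← shuffle_z, add_comm (_ * _),
        add_comm (Nat.succPNat _), ← stuffle_z]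
      exact hzero a
    · rw [map_sub, hT _ (z_succ_succ_mem_h0 a) _ (z_succ_succ_mem_h0 b), sub_self]

/-- The double zeta values with even arguments add up to three quarters of the zeta value. -/
theorem four_mul_sum_even_depth_two
    (hT : ∀ u ∈ h0 K, ∀ v ∈ h0 K, T (shuffle u v) = T (stuffle u v))
    (hreg : ∀ w₁ ∈ h1 K, ∀ w₀ ∈ h0 K,
      shuffle w₁ w₀ - stuffle w₁ w₀ ∈ h0 K → T (shuffle w₁ w₀ - stuffle w₁ w₀) = 0)
    {m : ℕ} (hm : m ≠ 0) :
    4 * ∑ i ∈ Finset.range m,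
      T (z K (2 * i + 1).succPNat * z K (2 * m - (2 * i + 1)).succPNat) =
      3 * T (z K (2 * m + 1).succPNat) := by
  have hsum := map_shuffle_z_sub_stuffle_z hT hreg 0 (2 * m) (by omega)
  rw [shuffle_sub_stuffle_z_one, map_sub, map_sum] at hsum
  -- The alternating sum complements the sum formula `hsum`: subtracting the two isolates the odd
  -- `a`, that is, the even arguments `a + 1`. The value of `T` on the non-admissible word `y
  -- z_{2m+1}` cancels in the end.
  have halt : ∑ a ∈ Finset.range (2 * m + 1), (-1) ^ a *
      T (shuffle (z K a.succPNat) (z K (2 * m - a).succPNat) -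
        stuffle (z K a.succPNat) (z K (2 * m - a).succPNat)) = 0 :=
    Finset.sum_eq_zero fun a ha => by
      rw [map_shuffle_z_sub_stuffle_z hT hreg _ _ (by rw [Finset.mem_range] at ha; omega), mul_zero]
  have hsh : ∑ a ∈ Finset.range (2 * m + 1), (-1) ^ a * T (depthOneShuffle K a (2 * m - a)) =
      2 * T (Y K * z K (2 * m).succPNat) := by
    obtain ⟨n, hn⟩ : ∃ n, 2 * m = n + 1 := ⟨2 * m - 1, by omega⟩
    have := congrArg T (sum_depthOneShuffle (K := K) n)
    rw [map_sum, map_zsmul, ← hn, pow_mul, neg_one_sq, one_pow, show n + 2 = 2 * m + 1 by omega]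
      at this
    rw [show (2 : A) * T (Y K * z K (2 * m).succPNat) =
      (1 + 1 : ℤ) • T (Y K * z K (2 * m).succPNat) by simp, ← this]
    refine Finset.sum_congr rfl fun a _ => ?_
    rw [map_zsmul]
    simp
  have hrefl : ∑ a ∈ Finset.range (2 * m + 1), (-1) ^ a *
      T (z K (2 * m - a).succPNat * z K a.succPNat) =
      ∑ a ∈ Finset.range (2 * m + 1), (-1) ^ a *
        T (z K a.succPNat * z K (2 * m - a).succPNat) := by
    rw [← Finset.sum_range_reflect]
    refine Finset.sum_congr rfl fun a ha => ?_
    rw [Finset.mem_range] at ha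
    rw [show 2 * m + 1 - 1 - a = 2 * m - a by omega, show 2 * m - (2 * m - a) = a by omega,
      neg_one_pow_congr (n := a)]
    rw [Nat.even_sub (by omega)]
    simp
  have hconst : ∑ a ∈ Finset.range (2 * m + 1), (-1) ^ a * T (z K (2 * m + 1).succPNat) =
      T (z K (2 * m + 1).succPNat) := by
    have := sum_range_one_sub_neg_one_pow_mul (fun _ => T (z K (2 * m + 1).succPNat)) m
    simp only [sub_mul, one_mul, Finset.sum_sub_distrib, Finset.sum_const, Finset.card_range,
      nsmul_eq_mul] at this
    push_cast at this
    linear_combination -this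
  have hst : ∀ a ∈ Finset.range (2 * m + 1), (-1) ^ a *
      T (shuffle (z K a.succPNat) (z K (2 * m - a).succPNat) -
        stuffle (z K a.succPNat) (z K (2 * m - a).succPNat)) =
      (-1) ^ a * T (depthOneShuffle K a (2 * m - a)) -
        ((-1) ^ a * T (z K a.succPNat * z K (2 * m - a).succPNat) +
          (-1) ^ a * T (z K (2 * m - a).succPNat * z K a.succPNat) +
          (-1) ^ a * T (z K (2 * m + 1).succPNat)) := fun a ha => by
    rw [Finset.mem_range] at ha
    rw [shuffle_z, stuffle_z, succPNat_add_succPNat, show a + (2 * m - a) = 2 * m by omega,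
      map_sub, map_add, map_add]
    ring
  rw [Finset.sum_congr rfl hst, Finset.sum_sub_distrib, Finset.sum_add_distrib,
    Finset.sum_add_distrib, hsh, hrefl, hconst] at halt
  have hodd := sum_range_one_sub_neg_one_pow_mul
    (fun a => T (z K a.succPNat * z K (2 * m - a).succPNat)) m
  simp only [sub_mul, one_mul, Finset.sum_sub_distrib] at hodd
  rw [Finset.sum_range_succ', z_zero_succPNat, Nat.sub_zero] at hodd
  linear_combination 2 * hsum - 2 * hodd + halt

/-- Euler's recursion for the even zeta values. -/
theorem euler_recursion
    (hT : ∀ u ∈ h0 K, ∀ v ∈ h0 K, T (shuffle u v) = T (stuffle u v))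
    (hst : ∀ u ∈ h0 K, ∀ v ∈ h0 K, T (stuffle u v) = T u * T v)
    (hreg : ∀ w₁ ∈ h1 K, ∀ w₀ ∈ h0 K,
      shuffle w₁ w₀ - stuffle w₁ w₀ ∈ h0 K → T (shuffle w₁ w₀ - stuffle w₁ w₀) = 0)
    (m : ℕ) :
    2 * ∑ i ∈ Finset.range (m + 1), T (z K (i.succPNat * 2)) * T (z K ((m - i).succPNat * 2)) =
      (2 * m + 5) * T (z K ((m + 1).succPNat * 2)) := by
  have hz : ∀ i : ℕ, i.succPNat * 2 = (2 * i + 1).succPNat := fun i => by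
    apply PNat.eq
    simp only [PNat.mul_coe, Nat.succPNat_coe, PNat.val_ofNat]
    omega
  have h4 := four_mul_sum_even_depth_two hT hreg m.succ_ne_zero
  have hrefl : ∑ i ∈ Finset.range (m + 1),
      T (z K (2 * (m - i) + 1).succPNat * z K (2 * i + 1).succPNat) =
      ∑ i ∈ Finset.range (m + 1),
        T (z K (2 * i + 1).succPNat * z K (2 * (m - i) + 1).succPNat) := by
    rw [← Finset.sum_range_reflect]
    refine Finset.sum_congr rfl fun i hi => ?_
    rw [Finset.mem_range] at hi
    rw [show m + 1 - 1 - i = m - i by omega, show m - (m - i) = i by omega]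
  have hprod : ∀ i ∈ Finset.range (m + 1),
      T (z K (i.succPNat * 2)) * T (z K ((m - i).succPNat * 2)) =
      T (z K (2 * i + 1).succPNat * z K (2 * (m - i) + 1).succPNat) +
        T (z K (2 * (m - i) + 1).succPNat * z K (2 * i + 1).succPNat) +
        T (z K ((m + 1).succPNat * 2)) := fun i hi => by
    rw [Finset.mem_range] at hi
    rw [hz, hz, ← hst _ (z_succ_succ_mem_h0 _) _ (z_succ_succ_mem_h0 _), stuffle_z, map_add,
      map_add, succPNat_add_succPNat, hz,
      show 2 * i + 1 + (2 * (m - i) + 1) + 1 = 2 * (m + 1) + 1 by omega]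
  rw [Finset.sum_congr rfl hprod, Finset.sum_add_distrib, Finset.sum_add_distrib, hrefl, hz]
  rw [Finset.sum_congr rfl fun i hi => by
    rw [show 2 * (m + 1) - (2 * i + 1) = 2 * (m - i) + 1 by rw [Finset.mem_range] at hi; omega]]
    at h4
  simp only [Finset.sum_const, Finset.card_range, nsmul_eq_mul]
  push_cast at h4 ⊢
  linear_combination h4

end Euler

/-! ### Differential equations for the generating series. -/

section Series

open PowerSeries

variable {A : Type*} [CommRing A]

/-- Positive-degree coefficients are Euler's recursion, with `2m + 5 = 3 + 2(m + 1)`; the constant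
term fixes the inhomogeneity. -/
theorem powerSumSeries_two_ode {K : Type*} [Field K] {T : NC K →+ A}
    (hT : ∀ u ∈ h0 K, ∀ v ∈ h0 K, T (shuffle u v) = T (stuffle u v))
    (hst : ∀ u ∈ h0 K, ∀ v ∈ h0 K, T (stuffle u v) = T u * T v)
    (hreg : ∀ w₁ ∈ h1 K, ∀ w₀ ∈ h0 K,
      shuffle w₁ w₀ - stuffle w₁ w₀ ∈ h0 K → T (shuffle w₁ w₀ - stuffle w₁ w₀) = 0) :
    3 * powerSumSeries T 2 + 2 * (PowerSeries.X * d⁄dX A (powerSumSeries T 2)) =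
      2 * (PowerSeries.X * powerSumSeries T 2 ^ 2) + 3 * PowerSeries.C (T (z K 2)) := by
  have hcoeff : ∀ (n : ℕ) (r : ℕ) [r.AtLeastTwo] (g : A⟦X⟧),
      coeff n ((OfNat.ofNat r : A⟦X⟧) * g) = (OfNat.ofNat r : A) * coeff n g :=
    fun n r _ g => by
      rw [← Nat.cast_ofNat (R := A⟦X⟧), ← Nat.cast_ofNat (R := A), ← nsmul_eq_mul, map_nsmul,
        nsmul_eq_mul]
  ext n
  rw [map_add, map_add, hcoeff, hcoeff, hcoeff, hcoeff]
  rcases n with _ | n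
  · simp [powerSumSeries, zero_succPNat_mul]
  · rw [coeff_succ_X_mul, coeff_succ_X_mul, coeff_derivative, coeff_C, if_neg n.succ_ne_zero, sq,
      coeff_mul, Finset.Nat.sum_antidiagonal_eq_sum_range_succ
        (fun i j => coeff i (powerSumSeries T 2) * coeff j (powerSumSeries T 2))]
    simp only [powerSumSeries, coeff_mk, Nat.succ_eq_add_one]
    rw [euler_recursion hT hst hreg]
    ring

theorem coeff_two_mul (n : ℕ) (g : A⟦X⟧) : coeff n (2 * g) = 2 * coeff n g := by
  rw [two_mul, two_mul, map_add]

/-- A power series with `2 u g'' + 3 g' + 3 p g = 0` is determined by its constant term. -/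
theorem coeff_of_second_order {g f : A⟦X⟧} {p : A} (hg0 : constantCoeff g = 1)
    (hg : d⁄dX A g = -f * g)
    (hf : 3 * f + 2 * (PowerSeries.X * d⁄dX A f) =
      2 * (PowerSeries.X * f ^ 2) + 3 * PowerSeries.C p) (n : ℕ) :
    ((2 * n + 1).factorial : A) * coeff n g = (-6 * p) ^ n := by
  -- Since `f` is minus the logarithmic derivative of `g`, `(f² - f') g = g''`; multiplying the
  -- Riccati equation by `g` makes it linear.
  have hode : 2 * (PowerSeries.X * d⁄dX A (d⁄dX A g)) = -(PowerSeries.C 3 * d⁄dX A g) -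
      PowerSeries.C (3 * p) * g := by
    have h2 : d⁄dX A (d⁄dX A g) = (f ^ 2 - d⁄dX A f) * g := by
      rw [hg, Derivation.leibniz, hg, map_neg]
      simp only [smul_eq_mul]
      ring
    rw [h2, hg, map_mul, show (PowerSeries.C (3 : A)) = 3 from map_ofNat _ 3]
    linear_combination -g * hf
  have hrec : ∀ n : ℕ, ((n : A) + 1) * ((2 * n + 3) * coeff (n + 1) g) = -3 * p * coeff n g := by
    intro n
    have := congrArg (coeff n) hode
    rw [coeff_two_mul, map_sub, map_neg, coeff_C_mul, coeff_C_mul] at this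
    rcases n with _ | n
    · rw [coeff_zero_X_mul, coeff_derivative] at this
      push_cast at this ⊢
      linear_combination this
    · rw [coeff_succ_X_mul, coeff_derivative, coeff_derivative] at this
      push_cast at this ⊢
      linear_combination this
  induction n with
  | zero => simpa using hg0
  | succ n ih =>
    rw [show 2 * (n + 1) + 1 = 2 * n + 1 + 1 + 1 by ring, Nat.factorial_succ, Nat.factorial_succ,
      pow_succ, ← ih]
    push_cast
    linear_combination (2 * ((2 * n + 1).factorial : A)) * hrec n

theorem derivative_rescale (a : A) (g : A⟦X⟧) :
    d⁄dX A (rescale a g) = PowerSeries.C a * rescale a (d⁄dX A g) := by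
  ext n
  rw [coeff_derivative, coeff_rescale, coeff_C_mul, coeff_rescale, coeff_derivative]
  ring

theorem derivative_expand (k : ℕ) (hk : k ≠ 0) (g : A⟦X⟧) :
    d⁄dX A (expand k hk g) =
      (k : A⟦X⟧) * PowerSeries.X ^ (k - 1) * expand k hk (d⁄dX A g) := by
  rw [expand_apply, derivative_subst (HasSubst.X_pow hk), expand_apply, derivative_pow,
    derivative_X, mul_one, mul_comm]

theorem derivative_prod_rescale {g f : A⟦X⟧} (hg : d⁄dX A g = -f * g) (w : A) (m : ℕ) :
    d⁄dX A (∏ j ∈ Finset.range m, rescale (w ^ j) g) =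
      -(∑ j ∈ Finset.range m, PowerSeries.C (w ^ j) * rescale (w ^ j) f) *
        ∏ j ∈ Finset.range m, rescale (w ^ j) g := by
  induction m with
  | zero => simp
  | succ m ih =>
    rw [Finset.prod_range_succ, Derivation.leibniz, ih, derivative_rescale, hg,
      Finset.sum_range_succ, map_mul, map_neg]
    simp only [smul_eq_mul]
    ring

variable [Algebra ℚ A]

theorem isUnit_natCast_succ (n : ℕ) : IsUnit ((n : A) + 1) := by
  have h : IsUnit ((n : ℚ) + 1) := isUnit_iff_ne_zero.2 (by positivity)
  simpa using h.map (algebraMap ℚ A)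

theorem coeff_expQuot_even (m : ℕ) : ((2 * m + 1).factorial : A) * coeff (2 * m) (expQuot A) =
    algebraMap ℚ A ((1 / 4) ^ m) := by
  rw [expQuot, coeff_mk, expDiff, map_sub, coeff_rescale, coeff_rescale, coeff_exp, ← map_pow,
    ← map_pow, ← map_natCast (algebraMap ℚ A), ← map_mul, ← map_mul, ← map_sub, ← map_mul]
  congr 1
  have : ((2 * m + 1).factorial : ℚ) ≠ 0 := by positivity
  rw [neg_div, Odd.neg_pow (odd_two_mul_add_one m)]
  field_simp
  rw [pow_succ, pow_mul]
  norm_num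
  ring_nf

theorem coeff_expQuot_odd (m : ℕ) : coeff (2 * m + 1) (expQuot A) = 0 := by
  rw [expQuot, coeff_mk, expDiff, map_sub, coeff_rescale, coeff_rescale, ← map_pow, ← map_pow,
    neg_div, Even.neg_pow ⟨m + 1, by ring⟩, sub_self]

/-- In degree `2m` both sides are `(-6p)^m w^{2m} / (2m+1)!`, because `λ²/4 = -6p`. The factorial
can be cancelled since it is a unit in a `ℚ`-algebra. -/
theorem rescale_expQuot {g : A⟦X⟧} {p lam w : A} (hlam : lam ^ 2 = -24 * p)
    (hg : ∀ n : ℕ, ((2 * n + 1).factorial : A) * coeff n g = (-6 * p) ^ n) :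
    rescale (lam * w) (expQuot A) = expand 2 two_ne_zero (rescale (w ^ 2) g) := by
  ext n
  rcases Nat.even_or_odd' n with ⟨m, rfl | rfl⟩
  · rw [coeff_rescale, coeff_expand_mul, coeff_rescale]
    have hu : IsUnit (((2 * m + 1).factorial : ℕ) : A) := by
      have h : IsUnit (((2 * m + 1).factorial : ℕ) : ℚ) := isUnit_iff_ne_zero.2 (by positivity)
      simpa using h.map (algebraMap ℚ A)
    apply hu.mul_left_cancel
    rw [mul_left_comm, coeff_expQuot_even, mul_left_comm, hg, mul_pow, pow_mul lam, hlam, pow_mul w,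
      map_pow, mul_right_comm, ← mul_pow, mul_comm _ ((w ^ 2) ^ m)]
    congr 2
    have h4 : algebraMap ℚ A (1 / 4) * 4 = 1 := by
      rw [← map_ofNat (algebraMap ℚ A) 4, ← map_mul]
      norm_num
    linear_combination -6 * p * h4
  · rw [coeff_rescale, coeff_expQuot_odd, mul_zero, coeff_expand_of_not_dvd]
    omega

/-- A first order linear differential equation has at most one solution with a given constant
term. -/
theorem eq_of_derivative_eq_mul {P Q h : A⟦X⟧} (hP : d⁄dX A P = h * P) (hQ : d⁄dX A Q = h * Q)
    (h0 : constantCoeff P = constantCoeff Q) : P = Q := by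
  ext n
  induction n using Nat.strong_induction_on with
  | _ n ih =>
    rcases n with _ | n
    · simpa using h0
    · apply (isUnit_natCast_succ (A := A) n).mul_right_cancel
      rw [← coeff_derivative, ← coeff_derivative, hP, hQ, coeff_mul, coeff_mul]
      refine Finset.sum_congr rfl fun ij hij => ?_
      rw [ih ij.2 (by have := Finset.HasAntidiagonal.mem_antidiagonal.1 hij; omega)]

/-- The product of the rescalings by the `k`-th roots of unity, for series given by their
logarithmic derivatives. -/
theorem prod_rescale_eq_expand {g f G F : A⟦X⟧} (hg : d⁄dX A g = -f * g)
    (hg0 : constantCoeff g = 1) (hG : d⁄dX A G = -F * G) (hG0 : constantCoeff G = 1)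
    {k : ℕ} (hk : k ≠ 0) {w : A}
    (hw : ∀ n : ℕ, ∑ j ∈ Finset.range k, (w ^ j) ^ n = if k ∣ n then (k : A) else 0)
    (hF : ∀ c n : ℕ, n + 1 = k * (c + 1) → coeff c F = coeff n f) :
    ∏ j ∈ Finset.range k, rescale (w ^ j) g = expand k hk G := by
  refine eq_of_derivative_eq_mul (derivative_prod_rescale hg w k) ?_ ?_
  · rw [derivative_expand, hG, map_mul, map_neg, ← mul_assoc]
    congr 1
    -- Both logarithmic derivatives are compared after multiplication by the variable. Summing over
    -- the powers of `w` then keeps exactly the degrees `n + 1` divisible by `k`.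
    rw [mul_neg, neg_inj]
    ext n
    rw [← coeff_succ_X_mul, show PowerSeries.X * ((k : A⟦X⟧) * PowerSeries.X ^ (k - 1) *
      expand k hk F) = k • expand k hk (PowerSeries.X * F) by
        rw [map_mul, expand_X, ← mul_pow_sub_one hk PowerSeries.X, nsmul_eq_mul]; ring]
    rw [map_nsmul, nsmul_eq_mul]
    simp only [map_sum, coeff_C_mul, coeff_rescale]
    have hsum : ∑ j ∈ Finset.range k, w ^ j * ((w ^ j) ^ n * coeff n f) =
        (∑ j ∈ Finset.range k, (w ^ j) ^ (n + 1)) * coeff n f := by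
      rw [Finset.sum_mul]
      exact Finset.sum_congr rfl fun j _ => by ring
    rw [hsum, hw]
    split_ifs with h
    · obtain ⟨_ | c, hc⟩ := h
      · omega
      · rw [hc, coeff_expand_mul, coeff_succ_X_mul, hF c n hc]
    · rw [coeff_expand_of_not_dvd _ _ _ h, mul_zero, zero_mul]
  · rw [map_prod, constantCoeff_expand, hG0]
    refine Finset.prod_eq_one fun j _ => ?_
    rw [← coeff_zero_eq_constantCoeff_apply, coeff_rescale, pow_zero, one_mul,
      coeff_zero_eq_constantCoeff_apply, hg0]

end Series

/-! ### Roots of unity, trivial regularization, and the theorem. -/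

/-- The square of `ρ_k` is the primitive `k`-th root `e^{2πi/k}`. The geometric sum is evaluated in
`ℂ`, because `A` need not be a domain; `φ` later carries the identity to `A`. -/
theorem sum_rho_pow (k : ℕ+) (n : ℕ) : ∑ j ∈ Finset.range k, ((rho k ^ 2) ^ j) ^ n =
    if (k : ℕ) ∣ n then (k : Algebra.adjoin ℚ {Complex.exp (Real.pi * Complex.I / (k : ℂ))})
      else 0 := by
  have hprim : IsPrimitiveRoot ((rho k : ℂ) ^ 2) k := by
    convert Complex.isPrimitiveRoot_exp k k.ne_zero using 1
    rw [rho, ← Complex.exp_nat_mul]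
    congr 1
    push_cast
    ring
  apply Subtype.ext
  push_cast
  simp only [← pow_mul (_ ^ 2), mul_comm _ n]
  simp only [pow_mul (_ ^ 2)]
  split_ifs with h
  · rw [(hprim.pow_eq_one_iff_dvd n).2 h]
    simp
  · have hne : ((rho k : ℂ) ^ 2) ^ n ≠ 1 := fun h' => h ((hprim.pow_eq_one_iff_dvd n).1 h')
    rw [geom_sum_eq hne, ← pow_mul, mul_comm n, pow_mul, hprim.pow_eq_one, one_pow, sub_self,
      zero_div]
    rfl

theorem shuffle_one_right {K : Type*} [Field K] (w : NC K) : shuffle w 1 = w := by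
  induction w using nc_induction with
  | hw w => rw [← word_nil, shuffle, wordLift_word, wordLift_word, shuffleWord_nil_right]
  | hadd p q hp hq => rw [map_add, LinearMap.add_apply, hp, hq]
  | hsmul c p hp => rw [map_smul, LinearMap.smul_apply, hp]

theorem isShuffleReg_self {K : Type*} [Field K] (r : h0 K) : IsShuffleReg (r : NC K) r := by
  classical
  refine ⟨Finsupp.single 0 r, ?_, Finsupp.single_eq_same⟩
  rw [Finsupp.sum_single_index (by simp), shufflePow, shuffle_one_right]

end MZV

end

theorem mainTheorem6 {K R A : Type*} [Field K] [CharZero K] [CommRing R] [Algebra K R]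
    (Z : MZV.h0 K →ₗ[K] R) (hZ : MZV.RegularizedDoubleShuffle Z) (k : ℕ+)
    [CommRing A] [Algebra R A] [Algebra ℚ A]
    (lam : A) (hlam : lam ^ 2 = algebraMap R A (-24 * MZV.zeta Z [2] (by simp [MZV.Admissible])))
    (φ : Algebra.adjoin ℚ {Complex.exp (Real.pi * Complex.I / (k : ℂ))} →ₐ[ℚ] A) :
    PowerSeries.expand (2 * (k : ℕ)) (mul_ne_zero two_ne_zero k.ne_zero)
        (PowerSeries.mk fun n : ℕ => (-1) ^ n *
          algebraMap R A (MZV.zeta Z (List.replicate n (2 * k)) (MZV.admissible_even k n))) =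
      ∏ j ∈ Finset.range k, PowerSeries.rescale (lam * φ (MZV.rho k) ^ j) (MZV.expQuot A) ∧
    PowerSeries.expand (2 * (k : ℕ)) (mul_ne_zero two_ne_zero k.ne_zero)
        (PowerSeries.mk fun n : ℕ =>
          algebraMap R A (MZV.zetaStar Z (List.replicate n (2 * k)) (MZV.admissible_even k n))) =
      ∏ j ∈ Finset.range k, PowerSeries.rescale (lam * φ (MZV.rho k) ^ j) (MZV.expQuotInv A) := by
  -- Any linear extension will do: its values outside `𝔥⁰` cancel wherever they occur.
  obtain ⟨Zt, hZt⟩ := LinearMap.exists_extend Z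
  have hval : ∀ u (hu : u ∈ MZV.h0 K), Zt u = Z ⟨u, hu⟩ := fun u hu => by rw [← hZt]; rfl
  let T : MZV.NC K →+ A := (algebraMap R A).toAddMonoidHom.comp Zt.toAddMonoidHom
  have hTdef : ∀ u (hu : u ∈ MZV.h0 K), T u = algebraMap R A (Z ⟨u, hu⟩) := fun u hu => by
    rw [← hval]; rfl
  obtain ⟨⟨hone, hds⟩, hreg⟩ := hZ
  have hT1 : T 1 = 1 := by
    rw [hTdef 1 MZV.one_mem_h0, ← map_one (algebraMap R A), ← hone]; rfl
  have hst : ∀ u ∈ MZV.h0 K, ∀ v ∈ MZV.h0 K, T (MZV.stuffle u v) = T u * T v :=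
    fun u hu v hv => by
      rw [hTdef _ (MZV.stuffle_mem_h0 hu hv), hTdef u hu, hTdef v hv, ← map_mul]
      exact congrArg _ (hds ⟨u, hu⟩ ⟨v, hv⟩).2
  have hsh : ∀ u ∈ MZV.h0 K, ∀ v ∈ MZV.h0 K, T (MZV.shuffle u v) = T (MZV.stuffle u v) :=
    fun u hu v hv => by
      rw [hst u hu v hv, hTdef _ (MZV.shuffle_mem_h0 hu hv), hTdef u hu, hTdef v hv, ← map_mul]
      exact congrArg _ (hds ⟨u, hu⟩ ⟨v, hv⟩).1
  have hregT : ∀ w₁ ∈ MZV.h1 K, ∀ w₀ ∈ MZV.h0 K,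
      MZV.shuffle w₁ w₀ - MZV.stuffle w₁ w₀ ∈ MZV.h0 K →
        T (MZV.shuffle w₁ w₀ - MZV.stuffle w₁ w₀) = 0 := fun w₁ h₁ w₀ h₀ h => by
    rw [hTdef _ h, hreg w₁ h₁ w₀ h₀ ⟨_, h⟩ (MZV.isShuffleReg_self ⟨_, h⟩), map_zero]
  have hp : algebraMap R A (-24 * MZV.zeta Z [2] (by simp [MZV.Admissible])) =
      -24 * T (MZV.z K 2) := by
    rw [map_mul, map_neg, map_ofNat, ← MZV.zWord_singleton,
      hTdef _ (MZV.zWord_mem_h0 (MZV.admissible_singleton le_rfl))]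
    rfl
  rw [hp] at hlam
  have hk := MZV.two_le_two_mul k
  have hfirst : PowerSeries.expand (2 * (k : ℕ)) (mul_ne_zero two_ne_zero k.ne_zero)
      (MZV.elemSeries T (2 * k)) =
      ∏ j ∈ Finset.range k, PowerSeries.rescale (lam * φ (MZV.rho k) ^ j) (MZV.expQuot A) := by
    have hg := MZV.derivative_elemSeries (s := 2) le_rfl hT1 hst
    have hcoeff := MZV.coeff_of_second_order (MZV.constantCoeff_elemSeries (s := 2) hT1) hg
      (MZV.powerSumSeries_two_ode hsh hst hregT)
    -- Each factor is `E_2` at `w^j t²`, so the substitution `t ↦ t^{2k}` splits into `t ↦ t²`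
    -- followed by the root-of-unity product in `u = t²`.
    rw [Finset.prod_congr rfl fun j _ => MZV.rescale_expQuot hlam hcoeff, ← map_prod,
      PowerSeries.expand_mul 2 two_ne_zero k k.ne_zero]
    congr 1
    rw [← MZV.prod_rescale_eq_expand hg (MZV.constantCoeff_elemSeries hT1)
      (MZV.derivative_elemSeries hk hT1 hst) (MZV.constantCoeff_elemSeries hT1) k.ne_zero
      (w := φ (MZV.rho k) ^ 2)]
    · exact Finset.prod_congr rfl fun j _ => by rw [pow_right_comm]
    · intro n
      have := congrArg φ (MZV.sum_rho_pow k n)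
      rw [map_sum, apply_ite φ, map_natCast, map_zero] at this
      simpa only [map_pow] using this
    · intro c n hcn
      rw [MZV.powerSumSeries, MZV.powerSumSeries, PowerSeries.coeff_mk, PowerSeries.coeff_mk]
      congr 2
      apply PNat.eq
      simp only [PNat.mul_coe, Nat.succPNat_coe, Nat.succ_eq_add_one, PNat.val_ofNat, hcn]
      ring
  have helem : (PowerSeries.mk fun n : ℕ => (-1) ^ n *
      algebraMap R A (MZV.zeta Z (List.replicate n (2 * k)) (MZV.admissible_even k n))) =
      MZV.elemSeries T (2 * k) := by
    ext n
    rw [MZV.elemSeries, PowerSeries.coeff_mk, PowerSeries.coeff_mk,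
      hTdef _ (MZV.zWord_mem_h0 (MZV.admissible_even k n)), MZV.zeta]
  have hstar : (PowerSeries.mk fun n : ℕ =>
      algebraMap R A (MZV.zetaStar Z (List.replicate n (2 * k)) (MZV.admissible_even k n))) =
      MZV.starSeries T (2 * k) := by
    ext n
    rw [MZV.starSeries, PowerSeries.coeff_mk, PowerSeries.coeff_mk,
      hTdef _ (MZV.S_mem_h0 (MZV.zWord_mem_h0 (MZV.admissible_even k n)))]
    rfl
  rw [helem, hstar]
  refine ⟨hfirst, ?_⟩
  -- The star series and the product of the `expQuotInv` are both inverse to the first product.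
  have hinv : PowerSeries.expand (2 * (k : ℕ)) (mul_ne_zero two_ne_zero k.ne_zero)
      (MZV.starSeries T (2 * k)) * ∏ j ∈ Finset.range k,
        PowerSeries.rescale (lam * φ (MZV.rho k) ^ j) (MZV.expQuot A) = 1 := by
    rw [← hfirst, ← map_mul, mul_comm (MZV.starSeries T _), MZV.elemSeries_mul_starSeries hk hT1 hst, map_one]
  refine left_inv_eq_right_inv hinv ?_
  rw [← Finset.prod_mul_distrib]
  exact Finset.prod_eq_one fun j _ => by rw [← map_mul, MZV.expQuot_mul_expQuotInv, map_one]
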